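/- Let $\tau$ be the morphism on words over $\{0,1,2\}$ given by $\tau(0)=012$, $\tau(1)=02$, $\tau(2)=1$, and let $\mathtt{vtm}=\tau^\omega(0)=012021012\cdots$ be its infinite fixed point starting with $0$. A word is squarefree if it has no factor $uu$ with $u$ non-empty. A position $j\ge 0$ of a squarefree infinite word $w$ is called disposable if, writing $w=uav$ with $a$ a letter and $|u|=j$, the word $uv$ is squarefree. Let $\mathcal A$ be the deterministic finite automaton over the alphabet $\{0,1\}$ with states $0,1,\dots,8$, initial state $0$, set of accepting states $\{0,2,8\}$, and the following transitions, where $q\mapsto(r,s)$ means that $\mathcal A$ moves from state $q$ to state $r$ on reading $0$ and to state $s$ on reading $1$: $$0\mapsto(0,1),\quad 1\mapsto(2,3),\quad 2\mapsto(4,5),\quad 3\mapsto(6,5),\quad 4\mapsto(7,1),\quad 5\mapsto(7,3),\quad 6\mapsto(8,5),\quad 7\mapsto(4,5),\quad 8\mapsto(7,1).$$ Then: (a) A position $j\ge 0$ of $\mathtt{vtm}$ is disposable if and only if $\mathcal A$ accepts the base-2 representation of $j$, read with the most significant digit first. This holds for the representation without leading zeros (the empty word for $j=0$) and for the representations with any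 number of leading zeros. (b) The set of differences $j-i$, where $0<i<j$ are disposable positions of $\mathtt{vtm}$ with no disposable position strictly between them, is exactly $\{6,10,26\}$. -/

import Mathlib

namespace DisposableVtm

/-- An infinite word over `α` (positions start at `0`) is squarefree if it has no factor `u u`
with `u` non-empty. -/
def IsSquarefree {α : Type*} (w : ℕ → α) : Prop :=
  ∀ i n : ℕ, 0 < n → ¬ ∀ k < n, w (i + k) = w (i + n + k)

/-- The infinite word obtained from `w` by deleting the letter at position `j`: if `w = u a v`
with `a` a letter and `u` of length `j`, this is `u v`. -/
def deleteAt {α : Type*} (w : ℕ → α) (j : ℕ) : ℕ → α :=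
  fun n => if n < j then w n else w (n + 1)

/-- Position `j` of the squarefree infinite word `w` is disposable: deleting the letter at `j`
leaves a squarefree word. -/
def IsDisposable {α : Type*} (w : ℕ → α) (j : ℕ) : Prop :=
  IsSquarefree w ∧ IsSquarefree (deleteAt w j)

/-- The morphism `0 ↦ 012`, `1 ↦ 02`, `2 ↦ 1` on letters. -/
def tauLetter : Fin 3 → List (Fin 3) :=
  ![[0, 1, 2], [0, 2], [1]]

/-- The morphism `τ` on finite words. -/
def tau (u : List (Fin 3)) : List (Fin 3) :=
  u.flatMap tauLetter

/-- The infinite word `τ^ω(0)`, the limit of the words `τ^n(0)`. -/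
def vtm (n : ℕ) : Fin 3 :=
  (tau^[n] [0]).getD n 0

theorem tau_append (u v : List (Fin 3)) : tau (u ++ v) = tau u ++ tau v := by
  simp [tau]

theorem tau_ne_nil {u : List (Fin 3)} (h : u ≠ []) : tau u ≠ [] := by
  cases u with
  | nil => exact absurd rfl h
  | cons a u => fin_cases a <;> simp [tau, tauLetter]

theorem exists_iterate_succ (n : ℕ) : ∃ s ≠ [], tau^[n + 1] [0] = tau^[n] [0] ++ s := by
  induction n with
  | zero => exact ⟨[1, 2], by simp, by simp [tau, tauLetter]⟩
  | succ n ih =>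
    obtain ⟨s, hs, h⟩ := ih
    refine ⟨tau s, tau_ne_nil hs, ?_⟩
    rw [Function.iterate_succ_apply', h, tau_append, ← Function.iterate_succ_apply' tau, h]

theorem lt_length_iterate (n : ℕ) : n < (tau^[n] [0]).length := by
  induction n with
  | zero => simp
  | succ n ih =>
    obtain ⟨s, hs, h⟩ := exists_iterate_succ n
    have := List.length_pos_of_ne_nil hs
    rw [h, List.length_append]
    omega

theorem iterate_prefix {m n : ℕ} (h : m ≤ n) : tau^[m] [0] <+: tau^[n] [0] := by
  induction n, h using Nat.le_induction with
  | base => exact List.prefix_rfl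
  | succ n _ ih =>
    obtain ⟨s, -, hs⟩ := exists_iterate_succ n
    rw [hs]
    exact ih.trans (List.prefix_append _ _)

/-- Every `τ^n(0)` is a prefix of `vtm`. -/
theorem iterate_getElem (n i : ℕ) (h : i < (tau^[n] [0]).length) :
    (tau^[n] [0])[i] = vtm i := by
  have hi := lt_length_iterate i
  rw [vtm, List.getD_eq_getElem _ _ hi]
  rcases le_total n i with hn | hn
  · exact (iterate_prefix hn).getElem h
  · exact ((iterate_prefix hn).getElem hi).symm

/-- The automaton `dispo_pos`, reading base-2 digits (`false` is `0`, `true` is `1`), most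
significant digit first. The `q`-th entry of the table lists the successors of state `q` under
`0` and under `1`. -/
def dispoPos : DFA Bool (Fin 9) where
  step q b :=
    let r : Fin 9 × Fin 9 :=
      ![(0, 1), (2, 3), (4, 5), (6, 5), (7, 1), (7, 3), (8, 5), (4, 5), (7, 1)] q
    if b then r.2 else r.1
  start := 0
  accept := {0, 2, 8}

/-- The base-2 representation of `j`, most significant digit first, without leading zeros
(so that `0` is represented by the empty word). -/
def binaryRep (j : ℕ) : List Bool :=
  (Nat.bits j).reverse

end DisposableVtm

namespace DisposableVtm

/-! ### The Thue–Morse word -/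

/-! `vtm` codes the differences of the Thue–Morse word (`vtm_eq_diffWord`): its letters 0, 1, 2 mark
a rise, no change, a fall. Overlap-freeness of Thue–Morse therefore makes `vtm` squarefree.

If the three letters on each side of a position (where they exist) force its letter, a square of
period at least 5 created by the deletion would already contradict squarefreeness of `vtm`
(`isSquarefree_deleteAt_of_forced`), so disposability is visible in a bounded window. That window
depends only on three consecutive Thue–Morse letters and the position modulo 8. A finite invariant,
stable under appending a digit, ties these letters to the automaton state (`mem_windowStates`). Part
(a) is then a finite check: accepted positions are forced without short squares, rejected ones show
a short square.

For (b), every gap after a positive disposable position is below 32, so it is read off from two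
consecutive blocks of 32 positions, whose possible pairs of states are bounded by
`mem_consecutiveStates`. -/

/-- The Thue–Morse word: the parity of the number of binary digits `1` of `n`. -/
def thueMorse (n : ℕ) : Bool :=
  (Nat.bits n).foldr xor false

theorem thueMorse_two_mul (n : ℕ) : thueMorse (2 * n) = thueMorse n := by
  rcases eq_or_ne n 0 with rfl | hn
  · simp
  · simp [thueMorse, Nat.bit0_bits n hn]

theorem thueMorse_two_mul_add_one (n : ℕ) : thueMorse (2 * n + 1) = !thueMorse n := by
  simp [thueMorse]

theorem thueMorse_ne_succ_of_even {n : ℕ} (h : Even n) : thueMorse n ≠ thueMorse (n + 1) := by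
  obtain ⟨a, rfl⟩ := even_iff_exists_two_mul.1 h
  simp [thueMorse_two_mul, thueMorse_two_mul_add_one]

theorem thueMorse_not_cube (n : ℕ) :
    ¬(thueMorse n = thueMorse (n + 1) ∧ thueMorse (n + 1) = thueMorse (n + 2)) := by
  rintro ⟨h₁, h₂⟩
  rcases Nat.even_or_odd n with h | h
  · exact thueMorse_ne_succ_of_even h h₁
  · exact thueMorse_ne_succ_of_even h.add_one h₂

/-- For `n = 2 * a + 1`, each inequality straddles two blocks and says that adjacent letters of the
word at `a`, `a + 1`, `a + 2` agree, which would be a cube. -/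
theorem thueMorse_not_ne_ne_of_odd {n : ℕ} (h : Odd n) :
    ¬(thueMorse n ≠ thueMorse (n + 1) ∧ thueMorse (n + 2) ≠ thueMorse (n + 3)) := by
  obtain ⟨a, rfl⟩ := h
  have e₁ := thueMorse_two_mul_add_one a
  have e₂ : thueMorse (2 * a + 1 + 1) = thueMorse (a + 1) := thueMorse_two_mul (a + 1)
  have e₃ : thueMorse (2 * a + 1 + 2) = !thueMorse (a + 1) := thueMorse_two_mul_add_one (a + 1)
  have e₄ : thueMorse (2 * a + 1 + 3) = thueMorse (a + 2) := thueMorse_two_mul (a + 2)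
  have := thueMorse_not_cube a
  rw [e₁, e₂, e₃, e₄]
  grind

/-- The Thue–Morse word has no overlap. -/
theorem thueMorse_not_overlap (i n : ℕ) (hn : 0 < n) :
    ¬∀ k ≤ n, thueMorse (i + k) = thueMorse (i + n + k) := by
  induction n using Nat.strong_induction_on generalizing i with
  | _ n ih =>
    intro h
    -- An even period descends to half the period by sampling every second letter. An odd period
    -- matches even positions with odd ones, where the pairs of unequal letters cannot be
    -- transported.
    rcases Nat.even_or_odd' n with ⟨e, rfl | rfl⟩
    · rcases Nat.even_or_odd' i with ⟨m, rfl | rfl⟩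
      · refine ih e (by omega) m (by omega) fun k hk => ?_
        have := h (2 * k) (by omega)
        rwa [← mul_add, ← mul_add, ← mul_add, thueMorse_two_mul, thueMorse_two_mul] at this
      · refine ih e (by omega) m (by omega) fun k hk => ?_
        have := h (2 * k) (by omega)
        rw [show 2 * m + 1 + 2 * k = 2 * (m + k) + 1 by ring,
          show 2 * m + 1 + 2 * e + 2 * k = 2 * (m + e + k) + 1 by ring,
          thueMorse_two_mul_add_one, thueMorse_two_mul_add_one] at this
        simpa using this
    · have h₀ := h 0 (by omega)
      have h₁ := h 1 (by omega)
      rcases Nat.eq_zero_or_pos e with rfl | he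
      · exact thueMorse_not_cube i ⟨h₀, h₁⟩
      have h₂ := h 2 (by omega)
      have h₃ := h 3 (by omega)
      rw [add_zero, add_zero] at h₀
      rcases Nat.even_or_odd i with hi | hi
      · refine thueMorse_not_ne_ne_of_odd (n := i + (2 * e + 1)) (by grind) ?_
        rw [← h₀, ← h₁, ← h₂, ← h₃]
        exact ⟨thueMorse_ne_succ_of_even hi, thueMorse_ne_succ_of_even (n := i + 2) (by grind)⟩
      · refine thueMorse_not_ne_ne_of_odd hi ?_
        rw [h₀, h₁, h₂, h₃]
        exact ⟨thueMorse_ne_succ_of_even (by grind),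
          thueMorse_ne_succ_of_even (n := i + (2 * e + 1) + 2) (by grind)⟩

/-! ### `vtm` as the difference word of the Thue–Morse word -/

/-- The letter `1 - (b - a)` for consecutive letters `a`, `b` of the Thue–Morse word. -/
def diffLetter (a b : Bool) : Fin 3 :=
  if a = b then 1 else if a then 2 else 0

/-- The word `1 - (t (n + 1) - t n)`, where `t` is the Thue–Morse word. -/
def diffWord (n : ℕ) : Fin 3 :=
  diffLetter (thueMorse n) (thueMorse (n + 1))

/-- The image of letter `n` has length `2 + t (n + 1) - t n`, so the lengths telescope. -/
theorem tau_map_diffWord_range (n : ℕ) :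
    tau ((List.range n).map diffWord) =
      (List.range (2 * n + (thueMorse n).toNat)).map diffWord := by
  induction n with
  | zero => simp [tau, thueMorse]
  | succ n ih =>
    rw [List.range_succ, List.map_append, tau_append, ih]
    have e₀ := thueMorse_two_mul n
    have e₁ := thueMorse_two_mul_add_one n
    have e₂ : thueMorse (2 * n + 2) = thueMorse (n + 1) := thueMorse_two_mul (n + 1)
    have e₃ : thueMorse (2 * n + 3) = !thueMorse (n + 1) := thueMorse_two_mul_add_one (n + 1)
    rcases h : thueMorse n <;> rcases h' : thueMorse (n + 1) <;>
      simp [tau, tauLetter, diffWord, diffLetter, h, h', mul_add, List.range_succ, e₀, e₁, e₂, e₃]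

theorem vtm_eq_diffWord (n : ℕ) : vtm n = diffWord n := by
  have key (m : ℕ) : ∃ L, tau^[m] [0] = (List.range L).map diffWord := by
    induction m with
    | zero => exact ⟨1, by simp [diffWord, diffLetter, thueMorse]⟩
    | succ m ih =>
      obtain ⟨L, hL⟩ := ih
      exact ⟨_, by rw [Function.iterate_succ_apply', hL, tau_map_diffWord_range]⟩
  obtain ⟨L, hL⟩ := key n
  have hn := lt_length_iterate n
  rw [vtm, List.getD_eq_getElem _ _ hn]
  simp [hL]

theorem isSquarefree_vtm : IsSquarefree vtm := by
  intro i n hn h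
  simp only [vtm_eq_diffWord, diffWord] at h
  -- Equal starting values integrate to an overlap. With different ones, equal differences must all
  -- vanish, since a rise starts only from 0 and a fall only from 1; both halves are then constant,
  -- and they meet at `i + n`.
  by_cases h₀ : thueMorse i = thueMorse (i + n)
  · refine thueMorse_not_overlap i n hn fun k => ?_
    induction k with
    | zero => exact fun _ => h₀
    | succ k ih =>
      intro hk
      have h₁ := h k hk
      rw [ih (by omega)] at h₁
      revert h₁
      rw [← add_assoc, ← add_assoc]
      generalize thueMorse (i + n + k) = a
      generalize thueMorse (i + k + 1) = b
      generalize thueMorse (i + n + k + 1) = c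
      revert a b c
      decide
  · have key : ∀ k ≤ n, thueMorse (i + k) = thueMorse i ∧
        thueMorse (i + n + k) = thueMorse (i + n) := by
      intro k
      induction k with
      | zero => simp
      | succ k ih =>
        intro hk
        have h₁ := h k hk
        rw [(ih (by omega)).1, (ih (by omega)).2] at h₁
        revert h₁ h₀
        rw [← add_assoc, ← add_assoc]
        generalize thueMorse i = a
        generalize thueMorse (i + n) = a'
        generalize thueMorse (i + k + 1) = b
        generalize thueMorse (i + n + k + 1) = c
        revert a a' b c
        decide
    exact h₀ (key n le_rfl).1.symm

/-- Between two rises of a binary word there must be a fall. -/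
theorem vtm_not_zero_one_zero (n : ℕ) : ¬(vtm n = 0 ∧ vtm (n + 1) = 1 ∧ vtm (n + 2) = 0) := by
  simp only [vtm_eq_diffWord, diffWord, add_assoc, Nat.reduceAdd]
  generalize thueMorse n = a, thueMorse (n + 1) = b, thueMorse (n + 2) = c, thueMorse (n + 3) = d
  revert a b c d
  decide

theorem vtm_not_two_one_two (n : ℕ) : ¬(vtm n = 2 ∧ vtm (n + 1) = 1 ∧ vtm (n + 2) = 2) := by
  simp only [vtm_eq_diffWord, diffWord, add_assoc, Nat.reduceAdd]
  generalize thueMorse n = a, thueMorse (n + 1) = b, thueMorse (n + 2) = c, thueMorse (n + 3) = d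
  revert a b c d
  decide

/-- Equal adjacent Thue–Morse letters start only at odd positions, and `n`, `n + 3` have opposite
parity. -/
theorem vtm_not_one_one_of_dist_three (n : ℕ) : ¬(vtm n = 1 ∧ vtm (n + 3) = 1) := by
  simp only [vtm_eq_diffWord, diffWord, add_assoc, Nat.reduceAdd, diffLetter]
  rintro ⟨h₁, h₂⟩
  rcases Nat.even_or_odd n with h | h
  · have := thueMorse_ne_succ_of_even h
    grind
  · have := thueMorse_ne_succ_of_even (n := n + 3) (by grind)
    grind

/-! ### Reduction to short squares -/

/-- If the three letters to the left, and the three letters to the right, of position `j`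
determine the letter at `j`, then only squares of period at most `4` can appear when the
letter at `j` is deleted. -/
theorem isSquarefree_deleteAt_of_forced {α : Type*} {w : ℕ → α} {j : ℕ} (hw : IsSquarefree w)
    (hl : 3 ≤ j → ∀ k, w k = w (j - 3) → w (k + 1) = w (j - 2) → w (k + 2) = w (j - 1) →
      w (k + 3) = w j)
    (hr : ∀ k, w (k + 1) = w (j + 1) → w (k + 2) = w (j + 2) → w (k + 3) = w (j + 3) →
      w k = w j)
    (hs : ∀ i n, 0 < n → n ≤ 4 → i < j → j < i + 2 * n →
      ¬∀ k < n, deleteAt w j (i + k) = deleteAt w j (i + n + k)) :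
    IsSquarefree (deleteAt w j) := by
  intro i n hn h
  have hlt : ∀ x < j, deleteAt w j x = w x := fun x hx => if_pos hx
  have hge : ∀ x, j ≤ x → deleteAt w j x = w (x + 1) := fun x hx => if_neg hx.not_gt
  have hne : ∀ x, w x ≠ w (x + 1) := fun x hx => hw x 1 one_pos fun k hk => by
    obtain rfl : k = 0 := by omega
    exact hx
  rcases le_or_gt j i with hi | hi
  · refine hw (i + 1) n hn fun k hk => ?_
    have := h k hk
    rw [hge _ (by omega), hge _ (by omega)] at this
    convert this using 2 <;> omega
  rcases le_or_gt (i + 2 * n) j with hj | hj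
  · refine hw i n hn fun k hk => ?_
    have := h k hk
    rwa [hlt _ (by omega), hlt _ (by omega)] at this
  refine hs i n hn ?_ hi hj h
  -- The half containing the deletion point now has at least 5 letters, so at least 3 lie before
  -- that point or at least 3 after it. Their copy in the other half forces the deleted letter there
  -- too.
  by_contra! hn4
  rcases le_or_gt j (i + n) with hm | hm
  · obtain ⟨p, rfl⟩ := Nat.exists_eq_add_of_lt hi
    have before : ∀ k < p + 1, w (i + k) = w (i + n + k + 1) := fun k hk => by
      have := h k (by omega)
      rwa [hlt _ (by omega), hge _ (by omega)] at this
    have after : ∀ k, p + 1 ≤ k → k < n → w (i + k + 1) = w (i + n + k + 1) := fun k hk hk' => by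
      have := h k hk'
      rwa [hge _ (by omega), hge _ (by omega)] at this
    rcases le_or_gt 2 p with hp | hp
    · obtain ⟨p, rfl⟩ := Nat.exists_eq_add_of_le' hp
      have forced : w (i + (p + 2) + 1) = w (i + n + (p + 3) + 1) :=
        (hl (by omega) (i + n + p + 1) (before p (by omega)).symm
          (before (p + 1) (by omega)).symm (before (p + 2) (by omega)).symm).symm
      -- Inside the first half the forced letter equals its right neighbour. At the boundary between
      -- the halves, restoring it gives a square of period `n + 1` in `w`.
      rcases hm.lt_or_eq with hm | hm
      · exact hne _ (forced.trans (after (p + 3) (by omega) (by omega)).symm)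
      · refine hw i (n + 1) (by omega) fun k hk => ?_
        have : i + (n + 1) + k = i + n + k + 1 := by ring
        rw [this]
        rcases (Nat.lt_succ_iff.1 hk).lt_or_eq with hk | rfl
        · exact before k (by omega)
        · obtain rfl : k = p + 3 := by omega
          exact forced
    · have forced : w (i + n + p + 1) = w (i + p + 1) :=
        hr (i + n + p + 1) (after (p + 1) (by omega) (by omega)).symm
          (after (p + 2) (by omega) (by omega)).symm (after (p + 3) (by omega) (by omega)).symm
      exact hne _ ((before p (by omega)).trans forced)
  · obtain ⟨p, rfl⟩ := Nat.exists_eq_add_of_lt hm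
    have before : ∀ k < p + 1, w (i + k) = w (i + n + k) := fun k hk => by
      have := h k (by omega)
      rwa [hlt _ (by omega), hlt _ (by omega)] at this
    have after : ∀ k, p + 1 ≤ k → k < n → w (i + k) = w (i + n + k + 1) := fun k hk hk' => by
      have := h k hk'
      rwa [hlt _ (by omega), hge _ (by omega)] at this
    rcases le_or_gt 2 p with hp | hp
    · obtain ⟨p, rfl⟩ := Nat.exists_eq_add_of_le' hp
      have forced : w (i + p + 3) = w (i + n + (p + 2) + 1) :=
        hl (by omega) (i + p) (before p (by omega)) (before (p + 1) (by omega))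
          (before (p + 2) (by omega))
      exact hne _ (forced.symm.trans (after (p + 3) (by omega) (by omega)))
    · have forced : w (i + p) = w (i + n + p + 1) :=
        hr (i + p) (after (p + 1) (by omega) (by omega))
          (after (p + 2) (by omega) (by omega)) (after (p + 3) (by omega) (by omega))
      exact hne (i + n + p) ((before p (by omega)).symm.trans forced)

/-! ### Letters of `vtm` forced by a neighbouring block of length three -/

theorem vtm_ne_succ (n : ℕ) : vtm n ≠ vtm (n + 1) := fun h =>
  isSquarefree_vtm n 1 one_pos fun k hk => by
    obtain rfl : k = 0 := by omega
    exact h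

/-- The pairs `(u, a)` such that `a` is the only letter that can follow the block `u` in `vtm`,
and the only letter that can precede the reversal of `u`. -/
def forcing : List ((Fin 3 × Fin 3 × Fin 3) × Fin 3) :=
  [((2, 0, 1), 2), ((1, 0, 2), 0), ((0, 2, 1), 0), ((1, 2, 0), 2)]

/-- In each case two of the three letters are excluded. The exclusions are symmetric under reversal,
so the lemma serves both directions. -/
theorem eq_of_forcing {a : Fin 3} {u : Fin 3 × Fin 3 × Fin 3} (hu : (u, a) ∈ forcing)
    {x : Fin 3} (h₀ : u.2.2 ≠ x) (h₁ : ¬(u.2.1 = 0 ∧ u.2.2 = 1 ∧ x = 0))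
    (h₂ : ¬(u.2.1 = 2 ∧ u.2.2 = 1 ∧ x = 2)) (h₃ : ¬(u.1 = 1 ∧ x = 1)) : x = a := by
  simp only [forcing, List.mem_cons, Prod.mk.injEq, List.not_mem_nil, or_false] at hu
  rcases hu with ⟨rfl, rfl⟩ | ⟨rfl, rfl⟩ | ⟨rfl, rfl⟩ | ⟨rfl, rfl⟩ <;> revert x <;> decide

theorem vtm_eq_of_forcing_left {a : Fin 3} {k : ℕ}
    (h : ((vtm k, vtm (k + 1), vtm (k + 2)), a) ∈ forcing) : vtm (k + 3) = a :=
  eq_of_forcing h (vtm_ne_succ _) (vtm_not_zero_one_zero _) (vtm_not_two_one_two _)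
    (vtm_not_one_one_of_dist_three _)

theorem vtm_eq_of_forcing_right {a : Fin 3} {k : ℕ}
    (h : ((vtm (k + 3), vtm (k + 2), vtm (k + 1)), a) ∈ forcing) : vtm k = a :=
  eq_of_forcing h (vtm_ne_succ _).symm
    (fun h => vtm_not_zero_one_zero k ⟨h.2.2, h.2.1, h.1⟩)
    (fun h => vtm_not_two_one_two k ⟨h.2.2, h.2.1, h.1⟩)
    (fun h => vtm_not_one_one_of_dist_three k ⟨h.2, h.1⟩)

theorem isDisposable_vtm_of_forcing {j : ℕ}
    (hl : 3 ≤ j → ((vtm (j - 3), vtm (j - 2), vtm (j - 1)), vtm j) ∈ forcing)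
    (hr : ((vtm (j + 3), vtm (j + 2), vtm (j + 1)), vtm j) ∈ forcing)
    (hs : ∀ i n, 0 < n → n ≤ 4 → i < j → j < i + 2 * n →
      ¬∀ k < n, deleteAt vtm j (i + k) = deleteAt vtm j (i + n + k)) :
    IsDisposable vtm j := by
  refine ⟨isSquarefree_vtm, isSquarefree_deleteAt_of_forced isSquarefree_vtm ?_ ?_ hs⟩
  · intro hj k h₀ h₁ h₂
    exact vtm_eq_of_forcing_left (by rw [h₀, h₁, h₂]; exact hl hj)
  · intro k h₁ h₂ h₃
    exact vtm_eq_of_forcing_right (by rw [h₁, h₂, h₃]; exact hr)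

/-! ### The automaton and the Thue–Morse word on blocks of positions -/

/-- The state of the automaton after reading the base-2 representation of `j`. -/
def dispoState (j : ℕ) : Fin 9 :=
  dispoPos.eval (binaryRep j)

theorem dispoState_two_mul (j : ℕ) : dispoState (2 * j) = dispoPos.step (dispoState j) false := by
  rcases eq_or_ne j 0 with rfl | hj
  -- The representation stays empty here; the identity holds because state 0 loops on digit 0.
  · decide
  · simp [dispoState, binaryRep, Nat.bit0_bits j hj]

theorem dispoState_two_mul_add_one (j : ℕ) :
    dispoState (2 * j + 1) = dispoPos.step (dispoState j) true := by
  simp [dispoState, binaryRep]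

theorem mem_accepts_iff (j k : ℕ) :
    List.replicate k false ++ binaryRep j ∈ dispoPos.accepts ↔
      dispoState j ∈ dispoPos.accept := by
  have h : dispoPos.eval (List.replicate k false) = dispoPos.start := by
    induction k with
    | zero => rfl
    | succ k ih => rw [List.replicate_succ', DFA.eval_append_singleton, ih]; rfl
  rw [DFA.mem_accepts, DFA.eval, DFA.evalFrom_of_append, ← DFA.eval, h]
  rfl

instance : DecidablePred (· ∈ dispoPos.accept) := fun q =>
  inferInstanceAs (Decidable (q = 0 ∨ q = 2 ∨ q = 8))

/-- The state reached from the state `q` by reading the `n` binary digits of `k`. -/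
def stepDigits : ℕ → Fin 9 → ℕ → Fin 9
  | 0, q, _ => q
  | n + 1, q, k => dispoPos.step (stepDigits n q (k / 2)) (k % 2 == 1)

/-- The sum modulo `2` of `a` and the `n` binary digits of `k`. -/
def xorDigits : ℕ → Bool → ℕ → Bool
  | 0, a, _ => a
  | n + 1, a, k => xor (xorDigits n a (k / 2)) (k % 2 == 1)

theorem dispoState_two_pow_mul_add (n m k : ℕ) (hk : k < 2 ^ n) :
    dispoState (2 ^ n * m + k) = stepDigits n (dispoState m) k := by
  induction n generalizing k with
  | zero => simp_all [stepDigits]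
  | succ n ih =>
    rw [stepDigits, ← ih (k / 2) (by omega)]
    rcases Nat.even_or_odd' k with ⟨l, rfl | rfl⟩
    · rw [show 2 ^ (n + 1) * m + 2 * l = 2 * (2 ^ n * m + l) by ring, dispoState_two_mul]
      simp
    · rw [show 2 ^ (n + 1) * m + (2 * l + 1) = 2 * (2 ^ n * m + l) + 1 by ring,
        dispoState_two_mul_add_one, show (2 * l + 1) / 2 = l by omega]
      simp

theorem thueMorse_two_pow_mul_add (n m k : ℕ) (hk : k < 2 ^ n) :
    thueMorse (2 ^ n * m + k) = xorDigits n (thueMorse m) k := by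
  induction n generalizing k with
  | zero => simp_all [xorDigits]
  | succ n ih =>
    rw [xorDigits, ← ih (k / 2) (by omega)]
    rcases Nat.even_or_odd' k with ⟨l, rfl | rfl⟩
    · rw [show 2 ^ (n + 1) * m + 2 * l = 2 * (2 ^ n * m + l) by ring, thueMorse_two_mul]
      simp
    · rw [show 2 ^ (n + 1) * m + (2 * l + 1) = 2 * (2 ^ n * m + l) + 1 by ring,
        thueMorse_two_mul_add_one, show (2 * l + 1) / 2 = l by omega]
      simp

/-! ### Recognising disposable positions in a window -/

/-- The word `f`, read at positions below `N`, has a square of period at most `4` when the letter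
at position `r` is deleted. -/
def HasShortSquare (f : ℕ → Fin 3) (N r : ℕ) : Prop :=
  ∃ n < 5, 0 < n ∧ ∃ i < N - 2 * n, ∀ k < n, deleteAt f r (i + k) = deleteAt f r (i + n + k)

/-- The conditions on the window `f` of length `N` that make position `r` disposable or not, in
accordance with the automaton being in state `q`. -/
def WindowAgrees (q : Fin 9) (f : ℕ → Fin 3) (N r : ℕ) : Prop :=
  if q ∈ dispoPos.accept then
    (3 ≤ r → ((f (r - 3), f (r - 2), f (r - 1)), f r) ∈ forcing) ∧
      ((f (r + 3), f (r + 2), f (r + 1)), f r) ∈ forcing ∧ ¬HasShortSquare f N r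
  else HasShortSquare f N r

instance (f : ℕ → Fin 3) (N r : ℕ) : Decidable (HasShortSquare f N r) := by
  unfold HasShortSquare; infer_instance

instance (q : Fin 9) (f : ℕ → Fin 3) (N r : ℕ) : Decidable (WindowAgrees q f N r) := by
  unfold WindowAgrees; infer_instance

/-- A square of length at most 8 across the deletion point involves only original positions from `r
- 7` to `r + 7`, which explains the bounds on `r`; with `b = 0` nothing is cut off on the left. -/
theorem isDisposable_vtm_iff_of_windowAgrees {q : Fin 9} {f : ℕ → Fin 3} {N r b : ℕ}
    (h : WindowAgrees q f N r) (hf : ∀ k < N, f k = vtm (b + k)) (hN : r + 8 ≤ N)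
    (hb : b = 0 ∨ 7 ≤ r) : IsDisposable vtm (b + r) ↔ q ∈ dispoPos.accept := by
  have hdel : ∀ k, k + 1 < N → deleteAt f r k = deleteAt vtm (b + r) (b + k) := fun k hk => by
    simp only [deleteAt, add_lt_add_iff_left]
    rw [hf k (by omega), hf (k + 1) hk, add_assoc]
  unfold WindowAgrees at h
  split_ifs at h with hq
  · simp only [hq, iff_true]
    obtain ⟨hl, hr, hs⟩ := h
    refine isDisposable_vtm_of_forcing (fun hj => ?_) ?_ fun i n hn hn4 hi hj hsq => hs ?_
    · have hr3 : 3 ≤ r := by omega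
      have := hl hr3
      rwa [hf _ (by omega), hf _ (by omega), hf _ (by omega), hf _ (by omega),
        ← Nat.add_sub_assoc hr3, ← Nat.add_sub_assoc (by omega),
        ← Nat.add_sub_assoc (by omega)] at this
    · rwa [hf _ (by omega), hf _ (by omega), hf _ (by omega), hf _ (by omega)] at hr
    · obtain ⟨i, rfl⟩ : ∃ i', i = b + i' := Nat.exists_eq_add_of_le (by omega)
      refine ⟨n, by omega, hn, i, by omega, fun k hk => ?_⟩
      rw [hdel _ (by omega), hdel _ (by omega)]
      convert hsq k hk using 2 <;> ring
  · simp only [hq, iff_false]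
    rintro ⟨-, hsf⟩
    obtain ⟨n, -, hn, i, hi, hsq⟩ := h
    refine hsf (b + i) n hn fun k hk => ?_
    have := hsq k hk
    rw [hdel _ (by omega), hdel _ (by omega)] at this
    convert this using 2 <;> ring

/-- Position `k` of the difference word of three consecutive blocks of length `8` of the
Thue–Morse word whose first letters are `a`, `b`, `c`. -/
def windowLetter (a b c : Bool) (k : ℕ) : Fin 3 :=
  diffLetter (letter k) (letter (k + 1))
where
  /-- Position `k` of the three blocks. -/
  letter (k : ℕ) : Bool := xorDigits 3 (if k < 8 then a else if k < 16 then b else c) (k % 8)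

theorem windowLetter_eq (m k : ℕ) (hk : k < 23) :
    windowLetter (thueMorse m) (thueMorse (m + 1)) (thueMorse (m + 2)) k =
      vtm (8 * m + k) := by
  have key : ∀ l < 24, windowLetter.letter (thueMorse m) (thueMorse (m + 1)) (thueMorse (m + 2)) l =
      thueMorse (8 * m + l) := fun l hl => by
    unfold windowLetter.letter
    have h := fun x => (thueMorse_two_pow_mul_add 3 x (l % 8) (by omega)).symm
    split_ifs
    all_goals
      rw [h]
      congr 1
      omega
  rw [vtm_eq_diffWord, diffWord, windowLetter, key k (by omega), key (k + 1) (by omega), add_assoc]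

/-- The values of the state after `m` and the letters `m - 1`, `m`, `m + 1` of the Thue–Morse
word. -/
def windowStates : List (Fin 9 × Bool × Bool × Bool) :=
  [(1, false, true, true), (1, true, false, false), (2, false, false, true),
    (2, true, true, false), (3, false, true, false), (3, true, false, true),
    (4, false, true, false), (4, true, false, true), (5, false, true, true),
    (5, true, false, false), (6, false, false, true), (6, true, true, false),
    (7, false, false, true), (7, true, true, false), (8, false, true, false),
    (8, true, false, true)]

/-- The list contains the tuple for `m = 0` and is closed under appending either digit to the middle
position `m + 1`. -/
theorem mem_windowStates (m : ℕ) :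
    (dispoState (m + 1), thueMorse m, thueMorse (m + 1), thueMorse (m + 2)) ∈ windowStates := by
  have step : ∀ x ∈ windowStates,
      (dispoPos.step x.1 false, !x.2.1, x.2.2.1, !x.2.2.1) ∈ windowStates ∧
      (dispoPos.step x.1 true, x.2.2.1, !x.2.2.1, x.2.2.2) ∈ windowStates := by
    decide +kernel
  induction m using Nat.strong_induction_on with
  | _ m ih =>
    rcases Nat.even_or_odd' m with ⟨l, rfl | rfl⟩
    · rcases Nat.eq_zero_or_pos l with rfl | hl
      · decide
      · obtain ⟨l, rfl⟩ := Nat.exists_eq_add_of_le' hl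
        have := (step _ (ih l (by omega))).2
        dsimp only at this
        rwa [← dispoState_two_mul_add_one, ← thueMorse_two_mul_add_one,
          ← thueMorse_two_mul (l + 1), ← thueMorse_two_mul (l + 2)] at this
    · have := (step _ (ih l (by omega))).1
      dsimp only at this
      rwa [← dispoState_two_mul, ← thueMorse_two_mul_add_one, ← thueMorse_two_mul_add_one,
        ← thueMorse_two_mul (l + 1)] at this

/-- The tested position lies in the middle block; 24 Thue–Morse letters give 23 differences, just
enough for the margin of 8 at `r = 7`. -/
theorem windowAgrees_of_mem : ∀ x ∈ windowStates, ∀ r < 8,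
    WindowAgrees (stepDigits 3 x.1 r) (windowLetter x.2.1 x.2.2.1 x.2.2.2) 23 (8 + r) := by
  decide +kernel

theorem windowAgrees_start : ∀ r < 8,
    WindowAgrees (stepDigits 3 0 r) (windowLetter false true true) 15 r := by
  decide +kernel

theorem isDisposable_vtm_iff (j : ℕ) : IsDisposable vtm j ↔ dispoState j ∈ dispoPos.accept := by
  have hj := Nat.div_add_mod j 8
  have hr : j % 8 < 8 := Nat.mod_lt _ (by norm_num)
  have hst := dispoState_two_pow_mul_add 3 (j / 8) (j % 8) hr
  rw [show 2 ^ 3 = 8 from rfl, hj] at hst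
  rw [hst]
  rcases hm : j / 8 with - | m
  · rw [hm, mul_zero] at hj
    have := isDisposable_vtm_iff_of_windowAgrees (windowAgrees_start (j % 8) hr) (b := 0)
      (fun k hk => windowLetter_eq 0 k (by omega)) (by omega) (Or.inl rfl)
    rwa [hj] at this
  · have := isDisposable_vtm_iff_of_windowAgrees
      (windowAgrees_of_mem _ (mem_windowStates m) (j % 8) hr) (b := 8 * m)
      (fun k hk => windowLetter_eq m k hk) (by omega) (Or.inr (by omega))
    rwa [show 8 * m + (8 + j % 8) = j by omega] at this

/-! ### Gaps between disposable positions -/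

/-- The pairs of states after consecutive positive numbers. -/
def consecutiveStates : List (Fin 9 × Fin 9) :=
  [(1, 2), (1, 7), (2, 3), (3, 4), (3, 8), (4, 5), (5, 2), (5, 6), (5, 7), (6, 5), (7, 1), (7, 3),
    (8, 5)]

/-- Consecutive numbers are either the two children of one number or the second child of one and the
first child of the next. -/
theorem mem_consecutiveStates (m : ℕ) :
    (dispoState (m + 1), dispoState (m + 2)) ∈ consecutiveStates := by
  have step : ∀ x ∈ consecutiveStates,
      (dispoPos.step x.1 false, dispoPos.step x.1 true) ∈ consecutiveStates ∧
      (dispoPos.step x.1 true, dispoPos.step x.2 false) ∈ consecutiveStates := by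
    decide +kernel
  induction m using Nat.strong_induction_on with
  | _ m ih =>
    rcases Nat.even_or_odd' m with ⟨l, rfl | rfl⟩
    · rcases Nat.eq_zero_or_pos l with rfl | hl
      · decide
      · obtain ⟨l, rfl⟩ := Nat.exists_eq_add_of_le' hl
        have := (step _ (ih l (by omega))).2
        rwa [← dispoState_two_mul_add_one, ← dispoState_two_mul] at this
    · have := (step _ (ih l (by omega))).1
      rwa [← dispoState_two_mul, ← dispoState_two_mul_add_one] at this

/-- The state after position `k` of two consecutive blocks of length `32` that begin in the
states `p` and `q`. -/
def blockState (p q : Fin 9) (k : ℕ) : Fin 9 :=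
  stepDigits 5 (if k < 32 then p else q) (k % 32)

theorem dispoState_eq_blockState (m k : ℕ) (hk : k < 64) :
    dispoState (32 * m + k) = blockState (dispoState m) (dispoState (m + 1)) k := by
  have h := fun x => (dispoState_two_pow_mul_add 5 x (k % 32) (by omega)).symm
  unfold blockState
  split_ifs
  all_goals
    rw [h]
    congr 1
    omega

/-- The accepting states at the positions `k` and later are at distance `6`, `10` or `26`. -/
def GapAt (p q : Fin 9) (k : ℕ) : Prop :=
  blockState p q k ∈ dispoPos.accept → ∃ g ∈ [6, 10, 26],
    blockState p q (k + g) ∈ dispoPos.accept ∧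
      ∀ l < g, 0 < l → blockState p q (k + l) ∉ dispoPos.accept

instance (p q : Fin 9) (k : ℕ) : Decidable (GapAt p q k) := by
  unfold GapAt; infer_instance

theorem gapAt_of_mem : ∀ x ∈ consecutiveStates, ∀ k < 32, GapAt x.1 x.2 k := by
  decide +kernel

/-- Position 0 must be left out: the next disposable position is 2. -/
theorem gapAt_start : ∀ k < 32, 0 < k → GapAt 0 1 k := by
  decide +kernel

theorem exists_next_accept (i : ℕ) (hi : 0 < i) (h : dispoState i ∈ dispoPos.accept) :
    ∃ g ∈ [6, 10, 26], dispoState (i + g) ∈ dispoPos.accept ∧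
      ∀ l < g, 0 < l → dispoState (i + l) ∉ dispoPos.accept := by
  have hk : i % 32 < 32 := Nat.mod_lt _ (by norm_num)
  have hblock : ∀ l < 32, dispoState (i + l) =
      blockState (dispoState (i / 32)) (dispoState (i / 32 + 1)) (i % 32 + l) := fun l hl => by
    rw [← dispoState_eq_blockState _ _ (by omega)]
    congr 1
    omega
  have hgap : GapAt (dispoState (i / 32)) (dispoState (i / 32 + 1)) (i % 32) := by
    rcases hm : i / 32 with - | m
    · exact gapAt_start _ hk (by omega)
    · exact gapAt_of_mem _ (mem_consecutiveStates m) _ hk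
  have h₀ := hblock 0 (by omega)
  simp only [add_zero] at h₀
  obtain ⟨g, hg, hacc, hnot⟩ := hgap (h₀ ▸ h)
  have hg32 : g < 32 := by
    simp only [List.mem_cons, List.not_mem_nil, or_false] at hg
    omega
  refine ⟨g, hg, hblock g hg32 ▸ hacc, fun l hl hl' => ?_⟩
  rw [hblock l (by omega)]
  exact hnot l hl hl'

end DisposableVtm

theorem mainTheorem2 :
    (∀ j k : ℕ, DisposableVtm.IsDisposable DisposableVtm.vtm j ↔
      List.replicate k false ++ DisposableVtm.binaryRep j ∈ DisposableVtm.dispoPos.accepts) ∧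
    {g : ℕ | ∃ i j : ℕ, 0 < i ∧ i < j ∧ j = i + g ∧
      DisposableVtm.IsDisposable DisposableVtm.vtm i ∧
      DisposableVtm.IsDisposable DisposableVtm.vtm j ∧
      ∀ m : ℕ, i < m → m < j → ¬ DisposableVtm.IsDisposable DisposableVtm.vtm m} =
      {6, 10, 26} := by
  open DisposableVtm in
  refine ⟨fun j k => by rw [isDisposable_vtm_iff, mem_accepts_iff], ?_⟩
  simp only [isDisposable_vtm_iff]
  ext g
  constructor
  · rintro ⟨i, j, hi, hij, rfl, hacc, hacc', hnot⟩
    obtain ⟨g', hg', hnext, hnot'⟩ := exists_next_accept i hi hacc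
    have hpos : 0 < g' := by
      simp only [List.mem_cons, List.not_mem_nil, or_false] at hg'
      omega
    rcases lt_trichotomy g g' with hlt | rfl | hlt
    · exact absurd hacc' (hnot' g hlt (by omega))
    · simpa using hg'
    · exact absurd hnext (hnot _ (by omega) (by omega))
  · have gap : ∀ k < 32, 0 < k → blockState 0 1 k ∈ dispoPos.accept → ∀ g < 32, 0 < g →
        blockState 0 1 (k + g) ∈ dispoPos.accept →
        (∀ l < k + g, k < l → blockState 0 1 l ∉ dispoPos.accept) →
        ∃ i j : ℕ, 0 < i ∧ i < j ∧ j = i + g ∧ dispoState i ∈ dispoPos.accept ∧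
          dispoState j ∈ dispoPos.accept ∧
          ∀ m : ℕ, i < m → m < j → dispoState m ∉ dispoPos.accept := by
      have hst : ∀ l < 64, dispoState l = blockState 0 1 l := fun l hl => by
        have := dispoState_eq_blockState 0 l hl
        rwa [mul_zero, zero_add] at this
      intro k hk hk0 hacc g hg hg0 hacc' hnot
      refine ⟨k, k + g, hk0, by omega, rfl, ?_, ?_, fun m hm hm' => ?_⟩
      · rwa [hst _ (by omega)]
      · rwa [hst _ (by omega)]
      · rw [hst _ (by omega)]
        exact hnot m hm' hm
    -- The gaps are realised by the consecutive disposable positions 12 and 18, 2 and 12, 18 and 44.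
    rintro (rfl | rfl | rfl)
    · exact gap 12 (by omega) (by omega) (by decide +kernel) 6 (by omega) (by omega)
        (by decide +kernel) (by decide +kernel)
    · exact gap 2 (by omega) (by omega) (by decide +kernel) 10 (by omega) (by omega)
        (by decide +kernel) (by decide +kernel)
    · exact gap 18 (by omega) (by omega) (by decide +kernel) 26 (by omega) (by omega)
        (by decide +kernel) (by decide +kernel)
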